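/- For positive integers $a,b$, the cycle-chord graph $\mathrm{CC}_{a,b}$ is obtained by identifying an edge of the cycle $C_{a+1}$ with an edge of the cycle $C_{b+1}$; equivalently, it has the vertices $v_0,\dots,v_{a+b-1}$, and its edges are those of the cycle $v_0v_1\cdots v_{a+b-1}v_0$ and the chord $v_0v_a$. A finite simple graph $G$ is called $e$-positive if its chromatic symmetric function $X_G=\sum_{\kappa}\prod_{v\in V(G)}x_{\kappa(v)}$, the sum being over all proper colorings $\kappa$ of $G$ by positive integers, is a linear combination with nonnegative coefficients of the elementary symmetric functions $e_\lambda=e_{\lambda_1}e_{\lambda_2}\cdots$, where $\lambda$ runs over integer partitions and $e_n=\sum_{1\le i_1<\cdots<i_n}x_{i_1}\cdots x_{i_n}$. For every integer $m\ge 3$, the cycle-chord graph $\mathrm{CC}_{m,3}$ is $e$-positive, and so is the graph obtained by adding the edge $v_2v_{m+1}$ to the cycle $v_1v_2\cdots v_{m+2}v_1$ (which is $\mathrm{CC}_{m-1,3}$). -/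

import Mathlib

noncomputable section

namespace ChromaticSymm

/-- The content of a map `κ : V → ℕ` : the exponent vector of the monomial `∏ v, x_{κ v}`. -/
def content {V : Type*} [Fintype V] (κ : V → ℕ) : ℕ →₀ ℕ :=
  ∑ v, Finsupp.single (κ v) 1

/-- Only finitely many maps from a finite set have a given content, so that the coefficients
of `chromaticSymm` below are honest counts. -/
theorem finite_content {V : Type*} [Fintype V] (m : ℕ →₀ ℕ) :
    {κ : V → ℕ | content κ = m}.Finite := by
  classical
  refine Set.Finite.subset (Set.Finite.pi' (fun _ : V => m.support.finite_toSet)) ?_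
  intro κ hκ v
  have h : content κ = m := hκ
  simp only [Finset.mem_coe, Finsupp.mem_support_iff, ← h, content, Finsupp.finsetSum_apply]
  intro h0
  have := (Finset.sum_eq_zero_iff.mp h0) v (Finset.mem_univ v)
  simp at this

/-- The chromatic symmetric function `X_G = ∑_κ ∏_{v ∈ V(G)} x_{κ(v)}` of a finite simple graph,
the sum being over all proper colourings `κ` of `G` with colours in `ℕ`, as a formal power series
in the countably many variables `x_0, x_1, …`: the coefficient of a monomial is the number of
proper colourings that contribute this monomial. -/
def chromaticSymm {V : Type*} [Fintype V] (G : SimpleGraph V) : MvPowerSeries ℕ ℚ :=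
  fun m => (Nat.card {κ : G.Coloring ℕ // content (fun v => κ v) = m} : ℚ)

open Classical in
/-- The elementary symmetric function `e_n = ∑_{i_1 < ⋯ < i_n} x_{i_1} ⋯ x_{i_n}` in the variables
`x_0, x_1, …`: the sum of all squarefree monomials of degree `n`. -/
def elemSymm (n : ℕ) : MvPowerSeries ℕ ℚ :=
  fun m => if (∀ i, m i ≤ 1) ∧ m.support.card = n then 1 else 0

/-- `e_λ = e_{λ_1} e_{λ_2} ⋯` for an integer partition `λ`. -/
def elemSymmPart {n : ℕ} (p : n.Partition) : MvPowerSeries ℕ ℚ :=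
  (p.parts.map elemSymm).prod

/-- A symmetric function is `e`-positive if it is a (finite) linear combination of the functions
`e_λ`, where `λ` runs over all integer partitions of all natural numbers, with nonnegative
coefficients.  (The `e_λ` are linearly independent, so the coefficients are unique.) -/
def EPositive (f : MvPowerSeries ℕ ℚ) : Prop :=
  ∃ c : (Σ n : ℕ, n.Partition) →₀ ℚ,
    (∀ p, 0 ≤ c p) ∧ f = c.sum fun p a => a • elemSymmPart p.2

/-- A finite graph is `e`-positive if its chromatic symmetric function is. -/
def GraphEPositive {V : Type*} [Fintype V] (G : SimpleGraph V) : Prop :=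
  EPositive (chromaticSymm G)

/-- The cycle with vertices `0, 1, …, n - 1`, in this cyclic order, together with the edge joining
the vertices `i` and `j`. -/
def cycleWithChord (n i j : ℕ) : SimpleGraph (Fin n) :=
  SimpleGraph.cycleGraph n ⊔ SimpleGraph.fromRel (fun u v : Fin n => u.val = i ∧ v.val = j)

/-- The cycle-chord graph `CC_{a,b}`, `a, b ≥ 1`, obtained by identifying an edge of the cycle
`C_{a+1}` with an edge of the cycle `C_{b+1}`: its vertices are `v_0, …, v_{a+b-1}`, and its edges
are those of the cycle `v_0 v_1 ⋯ v_{a+b-1} v_0` and the chord `v_0 v_a`. -/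
def cycleChordGraph (a b : ℕ) : SimpleGraph (Fin (a + b)) :=
  cycleWithChord (a + b) 0 a

end ChromaticSymm

end

open Finset

namespace ChromaticSymm

/-! The generating function, by number of vertices, of the chromatic symmetric functions of the
graphs `CC_{a,3}` has the form `N / (E - z E')`, where `E = ∑ e_n zⁿ`. Since `E - z E' = 1 - ∑_{n ≥
2} (n - 1) e_n zⁿ`, its reciprocal is `e`-positive, so it is enough that `N` has `e`-positive
coefficients.

To find `N`, let `z` mark vertices and work with finitely many colour weights `x_i`. Put `y_i = x_i
z`, `t_i = y_i / (1 + y_i)` and `T = ∑ t_i`. Paths whose end colours `j ≠ i` are fixed have the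
series `t_j t_i / (1 - T)` (`mul_pathSeries_of_ne`). The chord forces `j ≠ i`, and the two remaining
vertices contribute a polynomial in `y_i`, `y_j` and the power sums (`sum_two_interior`). Summing
over `i ≠ j` leaves only `T` and `Q = T² - ∑ t_i²` besides `e_1` and `e_2`
(`sum_off_diagonal_chord`). As `E T = z E'` and `E Q = z² E''`, multiplying by `E` gives the
denominator `E - z E'` and the explicit numerator of `coeff_chordNum`, whose coefficients are
visibly nonnegative.

Each coefficient of `X_G` involves finitely many colours, so the identity lifts to infinitely many
variables. The second graph is a rotation of `CC_{m-1,3}`. -/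

/-! ### The recursion and its numerator. -/

/-- Solution of the linear recursion with the generating function `∑ num n zⁿ / (E - z E')`, where
`E = ∑ e n zⁿ`. -/
def chordRec {R : Type*} [CommRing R] (e : ℕ → R) (num : ℕ → R) : ℕ → R
  | n => num n + ∑ j : Fin n, ((n - 1 - j : ℕ) : R) * (e (n - j) * chordRec e num j)

/-- Coefficients of the numerator of the generating function of the cycle-chord graphs `CC_{a,3}`. -/
def chordNum {R : Type*} [CommRing R] (e : ℕ → R) (n : ℕ) : R :=
  if n < 4 then 0 else
    ((3 * n * (n - 3) : ℕ) : R) * e n + ((2 * (n - 2) * (n - 4) : ℕ) : R) * (e 1 * e (n - 1))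
      + ((2 * (n - 3) * (n - 4) + 2 : ℕ) : R) * (e 2 * e (n - 2))

/-! ### Sums over pairs of colours. -/

theorem sum_sum_ite_ne {ι A : Type*} [Fintype ι] [DecidableEq ι] [AddCommGroup A]
    (f : ι → ι → A) :
    ∑ i, ∑ j, (if i ≠ j then f i j else 0) = ∑ i, ∑ j, f i j - ∑ i, f i i := by
  have h : ∀ i, ∑ j, (if i ≠ j then f i j else 0) = ∑ j, f i j - f i i := by
    intro i
    rw [eq_sub_iff_add_eq, ← Finset.sum_erase_add _ _ (mem_univ i),
      ← Finset.sum_erase_add (a := i) univ (fun j => f i j) (mem_univ i)]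
    simp only [ne_eq, not_true_eq_false, if_false, add_zero]
    congr 1
    refine Finset.sum_congr rfl fun j hj => ?_
    rw [if_pos (Finset.ne_of_mem_erase hj).symm]
  simp only [h, Finset.sum_sub_distrib]

/-- The relation `y_i t_i = y_i - t_i` removes every mixed product of `y_i` and `t_i`, so the double
sum splits into products of one-index sums. The subtracted diagonal reduces the same way, and no
power sum of `t` beyond the second survives. -/
theorem sum_off_diagonal_chord {ι A : Type*} [Fintype ι] [DecidableEq ι] [CommRing A]
    (y t : ι → A) (hyt : ∀ i, (1 + y i) * t i = y i) (e c T Q : A) (he : e = ∑ i, y i)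
    (hc : c = e ^ 2 - ∑ i, y i ^ 2) (hT : T = ∑ i, t i) (hQ : Q = T ^ 2 - ∑ i, t i ^ 2) :
    ∑ i, ∑ j, (if i ≠ j then t i * t j *
      (c - y i * (e - y i) - y j * (e - y j) + y i * y j) else 0)
      = Q * (c + 2 * e + 3) - T * (2 * c + 6 * e + 6) + (3 * c + 6 * e) := by
  have h1 : ∀ i j, t i * t j * (c - y i * (e - y i) - y j * (e - y j) + y i * y j)
      = c * (t i * t j) - e * ((y i - t i) * t j) - e * (t i * (y j - t j))
        + (y i ^ 2 - y i + t i) * t j + t i * (y j ^ 2 - y j + t j)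
        + (y i - t i) * (y j - t j) := by
    intro i j
    linear_combination (-e * t j - t j + y i * t j + y j * t j) * hyt i
      + (-e * t i + y j * t i - t i + y i - t i) * hyt j
  have h2 : ∀ i, t i * t i * (c - y i * (e - y i) - y i * (e - y i) + y i * y i)
      = c * t i ^ 2 - 2 * e * (y i - t i - t i ^ 2)
        + 3 * (y i ^ 2 - 2 * y i + 2 * t i + t i ^ 2) := by
    intro i
    linear_combination (-2 * e * (t i + 1) + 3 * (y i * t i + y i - t i - 2)) * hyt i
  rw [sum_sum_ite_ne]
  rw [Finset.sum_congr rfl fun i _ => h2 i]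
  simp only [h1, Finset.sum_add_distrib, Finset.sum_sub_distrib, ← Finset.mul_sum,
    ← Finset.sum_mul, ← he, ← hT]
  rw [hQ, hc]
  ring

/-- Inclusion-exclusion: the product of the sums omitting `i` and `j` respectively, minus the
diagonal `k = l`, which omits both. -/
theorem sum_two_interior {ι A : Type*} [Fintype ι] [DecidableEq ι] [CommRing A]
    (x : ι → A) {i j : ι} (hij : i ≠ j) :
    ∑ k, ∑ l, (if k ≠ i ∧ l ≠ j ∧ k ≠ l then x k * x l else 0)
      = (∑ k, x k) ^ 2 - ∑ k, x k ^ 2 - x i * (∑ k, x k - x i) - x j * (∑ k, x k - x j)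
        + x i * x j := by
  have h : ∀ k l, (if k ≠ i ∧ l ≠ j ∧ k ≠ l then x k * x l else 0)
      = (x k - if k = i then x k else 0) * (x l - if l = j then x l else 0)
        - if k = l then (x k - if k = i then x k else 0) * (x k - if k = j then x k else 0)
          else 0 := by
    intro k l
    by_cases h1 : k = i <;> by_cases h2 : l = j <;> by_cases h3 : k = l <;> simp_all
  have h' : ∀ k, (x k - if k = i then x k else 0) * (x k - if k = j then x k else 0)
      = x k ^ 2 - (if k = i then x k ^ 2 else 0) - (if k = j then x k ^ 2 else 0) := by
    intro k
    by_cases h1 : k = i <;> by_cases h2 : k = j <;> simp_all [sq]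
  simp only [h, h', Finset.sum_sub_distrib, ← Finset.mul_sum, ← Finset.sum_mul,
    Finset.sum_ite_eq, Finset.sum_ite_eq', mem_univ, if_true]
  ring

/-! ### The series `E` and its derivatives. -/

/-- The elementary symmetric polynomial of degree `k` in the finite family `x`. -/
def finEsymm {ι R : Type*} [Fintype ι] [CommRing R] (x : ι → R) (k : ℕ) : R :=
  ∑ t ∈ powersetCard k (univ : Finset ι), ∏ i ∈ t, x i

/-- The generating function `∏ (1 + x i z)` of the elementary symmetric polynomials. -/
noncomputable def esymmSeries {ι R : Type*} [Fintype ι] [CommRing R] (x : ι → R) : PowerSeries R :=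
  ∏ i, (1 + PowerSeries.X * PowerSeries.C (x i))

theorem coeff_esymmSeries {ι R : Type*} [Fintype ι] [CommRing R] (x : ι → R) (k : ℕ) :
    PowerSeries.coeff k (esymmSeries x) = finEsymm x k := by
  classical
  rw [esymmSeries, Finset.prod_one_add, map_sum, finEsymm, powersetCard_eq_filter, sum_filter]
  refine Finset.sum_congr rfl fun t _ => ?_
  rw [Finset.prod_mul_distrib, Finset.prod_const, ← map_prod, PowerSeries.coeff_mul_C,
    PowerSeries.coeff_X_pow]
  simp only [eq_comm (a := k), ite_mul, one_mul, zero_mul]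

theorem finEsymm_zero {ι R : Type*} [Fintype ι] [CommRing R] (x : ι → R) : finEsymm x 0 = 1 := by
  simp [finEsymm]

theorem finEsymm_one {ι R : Type*} [Fintype ι] [CommRing R] (x : ι → R) :
    finEsymm x 1 = ∑ i, x i := by
  simp [finEsymm, powersetCard_one]

/-- Logarithmic derivative: `t i` is `z` times that of the factor `1 + x i z`. -/
theorem X_mul_derivative_prod {ι R : Type*} [CommRing R] (x : ι → R)
    (t : ι → PowerSeries R)
    (ht : ∀ i, (1 + PowerSeries.X * PowerSeries.C (x i)) * t i
      = PowerSeries.X * PowerSeries.C (x i)) (s : Finset ι) :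
    PowerSeries.X * PowerSeries.derivative R
        (∏ i ∈ s, (1 + PowerSeries.X * PowerSeries.C (x i)))
      = (∏ i ∈ s, (1 + PowerSeries.X * PowerSeries.C (x i))) * ∑ i ∈ s, t i := by
  classical
  induction s using Finset.induction_on with
  | empty => simp
  | insert a s ha ih =>
    rw [prod_insert ha, sum_insert ha]
    simp only [Derivation.leibniz, map_add, smul_eq_mul, PowerSeries.derivative_X,
      PowerSeries.derivative_C, PowerSeries.derivative_one]
    linear_combination (1 + PowerSeries.X * PowerSeries.C (x a)) * ih
      - (∏ i ∈ s, (1 + PowerSeries.X * PowerSeries.C (x i))) * ht a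

/-- Each factor is linear in `z`, so the second derivative only hits ordered pairs of distinct
factors. -/
theorem X_sq_mul_derivative_derivative_prod {ι R : Type*} [CommRing R] (x : ι → R)
    (t : ι → PowerSeries R)
    (ht : ∀ i, (1 + PowerSeries.X * PowerSeries.C (x i)) * t i
      = PowerSeries.X * PowerSeries.C (x i)) (s : Finset ι) :
    PowerSeries.X ^ 2 * PowerSeries.derivative R (PowerSeries.derivative R
        (∏ i ∈ s, (1 + PowerSeries.X * PowerSeries.C (x i))))
      = (∏ i ∈ s, (1 + PowerSeries.X * PowerSeries.C (x i)))
        * ((∑ i ∈ s, t i) ^ 2 - ∑ i ∈ s, t i ^ 2) := by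
  classical
  induction s using Finset.induction_on with
  | empty => simp
  | insert a s ha ih =>
    have h1 := X_mul_derivative_prod x t ht s
    rw [prod_insert ha, sum_insert ha, sum_insert ha]
    simp only [Derivation.leibniz, map_add, smul_eq_mul, PowerSeries.derivative_X,
      PowerSeries.derivative_C, PowerSeries.derivative_one, map_zero]
    linear_combination (1 + PowerSeries.X * PowerSeries.C (x a)) * ih
      + 2 * (PowerSeries.X * PowerSeries.C (x a)) * h1
      - 2 * (∏ i ∈ s, (1 + PowerSeries.X * PowerSeries.C (x i))) * (∑ i ∈ s, t i) * ht a

theorem coeff_X_mul_derivative {R : Type*} [CommRing R] (f : PowerSeries R) (n : ℕ) :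
    PowerSeries.coeff n (PowerSeries.X * PowerSeries.derivative R f)
      = n * PowerSeries.coeff n f := by
  cases n with
  | zero => simp
  | succ n => rw [PowerSeries.coeff_succ_X_mul, PowerSeries.coeff_derivative]; push_cast; ring

theorem coeff_X_sq_mul_derivative_derivative {R : Type*} [CommRing R] (f : PowerSeries R)
    (n : ℕ) :
    PowerSeries.coeff n (PowerSeries.X ^ 2 *
      PowerSeries.derivative R (PowerSeries.derivative R f))
      = n * (n - 1) * PowerSeries.coeff n f := by
  have h : PowerSeries.X ^ 2 * PowerSeries.derivative R (PowerSeries.derivative R f)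
      = PowerSeries.X * PowerSeries.derivative R (PowerSeries.X * PowerSeries.derivative R f)
        - PowerSeries.X * PowerSeries.derivative R f := by
    simp only [Derivation.leibniz, smul_eq_mul, PowerSeries.derivative_X]
    ring
  rw [h, map_sub, coeff_X_mul_derivative, coeff_X_mul_derivative]
  ring

theorem two_mul_finEsymm_two {ι R : Type*} [Fintype ι] [CommRing R] (x : ι → R) :
    2 * finEsymm x 2 = (∑ i, x i) ^ 2 - ∑ i, x i ^ 2 := by
  classical
  have key : ∀ s : Finset ι,
      2 * ∑ t ∈ powersetCard 2 s, ∏ i ∈ t, x i = (∑ i ∈ s, x i) ^ 2 - ∑ i ∈ s, x i ^ 2 := by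
    intro s
    induction s using Finset.induction_on with
    | empty => simp [powersetCard_eq_empty.2 (show #(∅ : Finset ι) < 2 by simp)]
    | insert a s ha ih =>
      rw [powersetCard_succ_insert ha, sum_union, sum_image, sum_insert ha, sum_insert ha, mul_add,
        ih, powersetCard_one, sum_map]
      · have : ∀ i ∈ s, ∏ j ∈ insert a {i}, x j = x a * x i := by
          intro i hi
          rw [prod_insert (by simpa using fun h : a = i => ha (h ▸ hi)), prod_singleton]
        simp only [Function.Embedding.coeFn_mk]
        rw [sum_congr rfl this, ← mul_sum]
        ring
      · intro u hu v hv huv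
        have hu' : a ∉ u := fun h => ha ((mem_powersetCard.1 hu).1 h)
        have hv' : a ∉ v := fun h => ha ((mem_powersetCard.1 hv).1 h)
        rw [← erase_insert hu', ← erase_insert hv', huv]
      · rw [Finset.disjoint_left]
        intro u hu hu2
        obtain ⟨v, _, rfl⟩ := mem_image.1 hu2
        exact ha ((mem_powersetCard.1 hu).1 (mem_insert_self _ _))
  exact key univ

/-! ### Coefficients of the numerator and of the quotient. -/

/-- The numerator of the generating function of the cycle-chord graphs `CC_{a,3}`. -/
theorem coeff_chordNum {R : Type*} [CommRing R] (e : ℕ → R) (he : e 0 = 1)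
    (E : PowerSeries R) (hE : ∀ n, PowerSeries.coeff n E = e n) (n : ℕ) :
    PowerSeries.coeff n
      (PowerSeries.X ^ 2 * PowerSeries.derivative R (PowerSeries.derivative R E) *
          (PowerSeries.X ^ 2 * PowerSeries.C (2 * e 2) + 2 * (PowerSeries.X * PowerSeries.C (e 1))
            + 3)
        - PowerSeries.X * PowerSeries.derivative R E *
          (2 * (PowerSeries.X ^ 2 * PowerSeries.C (2 * e 2))
            + 6 * (PowerSeries.X * PowerSeries.C (e 1)) + 6)
        + E * (3 * (PowerSeries.X ^ 2 * PowerSeries.C (2 * e 2))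
            + 6 * (PowerSeries.X * PowerSeries.C (e 1)))) = chordNum e n := by
  set A := PowerSeries.X ^ 2 * PowerSeries.derivative R (PowerSeries.derivative R E) with hA
  set B := PowerSeries.X * PowerSeries.derivative R E with hB
  have cA : ∀ k, PowerSeries.coeff k A = k * (k - 1) * e k := fun k => by
    rw [hA, coeff_X_sq_mul_derivative_derivative, hE]
  have cB : ∀ k, PowerSeries.coeff k B = k * e k := fun k => by
    rw [hB, coeff_X_mul_derivative, hE]
  have h : (A * (PowerSeries.X ^ 2 * PowerSeries.C (2 * e 2)
          + 2 * (PowerSeries.X * PowerSeries.C (e 1)) + 3)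
        - B * (2 * (PowerSeries.X ^ 2 * PowerSeries.C (2 * e 2))
            + 6 * (PowerSeries.X * PowerSeries.C (e 1)) + 6)
        + E * (3 * (PowerSeries.X ^ 2 * PowerSeries.C (2 * e 2))
            + 6 * (PowerSeries.X * PowerSeries.C (e 1))))
      = PowerSeries.C 3 * A - PowerSeries.C 6 * B
        + PowerSeries.X * (PowerSeries.C (e 1) *
          (PowerSeries.C 2 * A - PowerSeries.C 6 * B + PowerSeries.C 6 * E))
        + PowerSeries.X * (PowerSeries.X * (PowerSeries.C (2 * e 2) *
          (A - PowerSeries.C 2 * B + PowerSeries.C 3 * E))) := by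
    simp only [map_ofNat]
    ring
  rw [h]
  simp only [map_add, map_sub]
  -- Below degree 4 the terms cancel, but the natural-number subtractions in `chordNum` would
  -- truncate; hence its cutoff.
  rcases n with _ | _ | _ | _ | n
  · simp [chordNum, cA, cB, PowerSeries.coeff_C_mul]
  · rw [PowerSeries.coeff_succ_X_mul 0, PowerSeries.coeff_succ_X_mul 0,
      PowerSeries.coeff_zero_X_mul]
    simp only [PowerSeries.coeff_C_mul, cA, cB, map_add, map_sub, hE, he, chordNum]
    norm_num
    ring
  · rw [PowerSeries.coeff_succ_X_mul (0 + 1), PowerSeries.coeff_succ_X_mul (0 + 1),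
      PowerSeries.coeff_succ_X_mul 0]
    simp only [PowerSeries.coeff_C_mul, cA, cB, map_add, map_sub, hE, he, chordNum]
    norm_num
    ring
  · simp only [PowerSeries.coeff_succ_X_mul, PowerSeries.coeff_C_mul, cA, cB, map_add, map_sub,
      hE, chordNum]
    norm_num
    ring
  · simp only [PowerSeries.coeff_succ_X_mul, PowerSeries.coeff_C_mul, cA, cB, map_add, map_sub,
      hE, chordNum]
    rw [if_neg (by omega)]
    rw [show n + 1 + 1 + 1 + 1 - 3 = n + 1 by omega, show n + 1 + 1 + 1 + 1 - 2 = n + 2 by omega,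
      show n + 1 + 1 + 1 + 1 - 4 = n by omega, show n + 1 + 1 + 1 + 1 - 1 = n + 3 by omega]
    push_cast
    ring

theorem coeff_eq_chordRec {R : Type*} [CommRing R] (e num : ℕ → R) (he : e 0 = 1)
    (D W N : PowerSeries R) (hD : ∀ n : ℕ, PowerSeries.coeff n D = (1 - n) * e n)
    (hN : ∀ n, PowerSeries.coeff n N = num n) (hDW : W * D = N) (n : ℕ) :
    PowerSeries.coeff n W = chordRec e num n := by
  induction n using Nat.strong_induction_on with
  | _ n ih =>
    have h := congrArg (PowerSeries.coeff n) hDW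
    rw [PowerSeries.coeff_mul, hN, Finset.Nat.sum_antidiagonal_eq_sum_range_succ
      (fun i j => PowerSeries.coeff i W * PowerSeries.coeff j D), Finset.sum_range_succ,
      Nat.sub_self, hD, he] at h
    rw [chordRec, Fin.sum_univ_eq_sum_range
      (fun j => ((n - 1 - j : ℕ) : R) * (e (n - j) * chordRec e num j)) n, ← h]
    have h2 : ∑ j ∈ range n, PowerSeries.coeff j W * PowerSeries.coeff (n - j) D
        = - ∑ j ∈ range n, ((n - 1 - j : ℕ) : R) * (e (n - j) * chordRec e num j) := by
      rw [← Finset.sum_neg_distrib]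
      refine Finset.sum_congr rfl fun j hj => ?_
      have hj := Finset.mem_range.1 hj
      rw [ih j hj, hD]
      obtain ⟨k, rfl⟩ : ∃ k, n = j + 1 + k := ⟨n - (j + 1), by omega⟩
      rw [show j + 1 + k - j = k + 1 by omega, show j + 1 + k - 1 - j = k by omega]
      push_cast
      ring
    rw [h2]
    simp

/-! ### Colourings of paths with prescribed end colours. -/

/-- The weighted number of proper colourings of the path with `n + 1` vertices whose first vertex
has colour `j` and whose last vertex has colour `i`. -/
def pathWeight {ι R : Type*} [Fintype ι] [DecidableEq ι] [CommRing R] (x : ι → R) :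
    ℕ → ι → ι → R
  | 0, j, i => if j = i then x i else 0
  | n + 1, j, i => x i * ∑ k, if k ≠ i then pathWeight x n j k else 0

/-- The generating function of `pathWeight` by the number of vertices. -/
noncomputable def pathSeries {ι R : Type*} [Fintype ι] [DecidableEq ι] [CommRing R] (x : ι → R)
    (j i : ι) : PowerSeries R :=
  PowerSeries.X * PowerSeries.mk fun n => pathWeight x n j i

theorem sum_ite_ne {ι A : Type*} [Fintype ι] [DecidableEq ι] [AddCommGroup A] (f : ι → A)
    (i : ι) : ∑ k, (if k ≠ i then f k else 0) = ∑ k, f k - f i := by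
  have h : ∀ k, (if k ≠ i then f k else 0) = f k - if k = i then f k else 0 := by
    intro k
    by_cases h : k = i <;> simp [h]
  simp only [h, Finset.sum_sub_distrib, Finset.sum_ite_eq', mem_univ, if_true]

theorem pathSeries_eq {ι R : Type*} [Fintype ι] [DecidableEq ι] [CommRing R] (x : ι → R)
    (j i : ι) :
    pathSeries x j i = PowerSeries.X * PowerSeries.C (x i) *
      ((if j = i then 1 else 0) + ∑ k, pathSeries x j k - pathSeries x j i) := by
  rw [pathSeries, mul_assoc]
  congr 1
  ext n
  rw [PowerSeries.coeff_mk, PowerSeries.coeff_C_mul, map_sub, map_add, map_sum]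
  cases n with
  | zero => simp [pathSeries, pathWeight]
  | succ n =>
    simp only [pathSeries, PowerSeries.coeff_succ_X_mul, PowerSeries.coeff_mk, pathWeight,
      sum_ite_ne]
    by_cases h : j = i <;> simp [h, PowerSeries.coeff_one]

/-- With `S` the sum of the series over all last colours, the recursion gives `t i * S` for a last
colour `i ≠ j`, and an extra `t j` for `i = j`. Summing gives `S (1 - T) = t j`. -/
theorem mul_pathSeries_of_ne {ι R : Type*} [Fintype ι] [DecidableEq ι] [CommRing R] (x : ι → R)
    (t : ι → PowerSeries R)
    (ht : ∀ i, (1 + PowerSeries.X * PowerSeries.C (x i)) * t i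
      = PowerSeries.X * PowerSeries.C (x i))
    (hu : ∀ i, IsUnit (1 + PowerSeries.X * PowerSeries.C (x i)))
    {j i : ι} (hji : j ≠ i) :
    pathSeries x j i * (1 - ∑ k, t k) = t j * t i := by
  have h1 : ∀ i, pathSeries x j i
      = (if j = i then t i else 0) + t i * ∑ k, pathSeries x j k := by
    intro i
    apply (hu i).mul_left_cancel
    have h := pathSeries_eq x j i
    by_cases hj : j = i
    · simp only [hj, if_true] at h ⊢
      linear_combination h - (1 + ∑ k, pathSeries x i k) * ht i
    · simp only [hj, if_false] at h ⊢
      linear_combination h - (∑ k, pathSeries x j k) * ht i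
  have h2 : ∑ k, pathSeries x j k = t j + (∑ k, t k) * ∑ k, pathSeries x j k := by
    conv_lhs => rw [Finset.sum_congr rfl fun i _ => h1 i]
    rw [Finset.sum_add_distrib, Finset.sum_ite_eq, if_pos (mem_univ j), ← Finset.sum_mul]
  have h3 := h1 i
  rw [if_neg hji] at h3
  linear_combination (1 - ∑ k, t k) * h3 + t i * h2

theorem isUnit_one_add_X_mul {R : Type*} [CommRing R] (f : PowerSeries R) :
    IsUnit (1 + PowerSeries.X * f) := by
  rw [PowerSeries.isUnit_iff_constantCoeff]
  simp

/-- The weighted number of proper colourings of the graph formed by a path with `a + 1` vertices,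
the edge joining its ends, and a further path of length three joining its ends. -/
theorem sum_pathWeight_eq_chordRec {ι R : Type*} [Fintype ι] [DecidableEq ι] [CommRing R]
    (x : ι → R) (a : ℕ) :
    ∑ j, ∑ i, (if j ≠ i then pathWeight x a j i *
        ∑ k, ∑ l, (if k ≠ i ∧ l ≠ j ∧ k ≠ l then x k * x l else 0) else 0)
      = chordRec (finEsymm x) (chordNum (finEsymm x)) (a + 3) := by
  have hu : ∀ i, IsUnit (1 + PowerSeries.X * PowerSeries.C (x i)) :=
    fun i => isUnit_one_add_X_mul _
  choose u hu' using fun i => (hu i).exists_right_inv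
  obtain ⟨t, ht⟩ : ∃ t : ι → PowerSeries R, ∀ i, (1 + PowerSeries.X * PowerSeries.C (x i)) * t i
      = PowerSeries.X * PowerSeries.C (x i) :=
    ⟨fun i => PowerSeries.X * PowerSeries.C (x i) * u i, fun i => by
      linear_combination (PowerSeries.X * PowerSeries.C (x i)) * hu' i⟩
  have hE1 : PowerSeries.X * PowerSeries.derivative R (esymmSeries x)
      = esymmSeries x * ∑ i, t i := X_mul_derivative_prod x t ht univ
  have hE2 : PowerSeries.X ^ 2 * PowerSeries.derivative R (PowerSeries.derivative R
      (esymmSeries x)) = esymmSeries x * ((∑ i, t i) ^ 2 - ∑ i, t i ^ 2) :=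
    X_sq_mul_derivative_derivative_prod x t ht univ
  set g : ι → ι → R := fun j i =>
    ∑ k, ∑ l, (if k ≠ i ∧ l ≠ j ∧ k ≠ l then x k * x l else 0) with hg
  -- The degree `a + 3` counts the `a + 1` path vertices and the two interior vertices marked by `X
  -- ^ 2`.
  have hW : ∑ j, ∑ i, (if j ≠ i then pathWeight x a j i * g j i else 0)
      = PowerSeries.coeff (a + 3) (∑ j, ∑ i, (if j ≠ i then
        pathSeries x j i * (PowerSeries.X ^ 2 * PowerSeries.C (g j i)) else 0)) := by
    simp only [map_sum]
    refine Finset.sum_congr rfl fun j _ => Finset.sum_congr rfl fun i _ => ?_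
    split_ifs with h
    · rw [pathSeries, show ∀ f : PowerSeries R, PowerSeries.X * f *
        (PowerSeries.X ^ 2 * PowerSeries.C (g j i))
        = PowerSeries.X * (PowerSeries.X * (PowerSeries.X * (f * PowerSeries.C (g j i)))) from
        fun f => by ring, PowerSeries.coeff_succ_X_mul, PowerSeries.coeff_succ_X_mul,
        PowerSeries.coeff_succ_X_mul, PowerSeries.coeff_mul_C, PowerSeries.coeff_mk]
    · simp
  rw [hW]
  refine coeff_eq_chordRec (finEsymm x) _ (finEsymm_zero x)
    (esymmSeries x - PowerSeries.X * PowerSeries.derivative R (esymmSeries x)) _ _ ?_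
    (coeff_chordNum (finEsymm x) (finEsymm_zero x) (esymmSeries x) (coeff_esymmSeries x)) ?_ _
  · intro n
    rw [map_sub, coeff_X_mul_derivative, coeff_esymmSeries]
    ring
  · set e := PowerSeries.X * PowerSeries.C (finEsymm x 1) with he
    set c := PowerSeries.X ^ 2 * PowerSeries.C (2 * finEsymm x 2) with hc
    have he' : e = ∑ i, PowerSeries.X * PowerSeries.C (x i) := by
      rw [he, finEsymm_one, map_sum, Finset.mul_sum]
    have hc' : c = e ^ 2 - ∑ i, (PowerSeries.X * PowerSeries.C (x i)) ^ 2 := by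
      rw [hc, two_mul_finEsymm_two, he, finEsymm_one]
      simp only [map_sub, map_pow, map_sum, mul_pow, ← Finset.mul_sum]
      ring
    rw [hE1, hE2]
    have key := sum_off_diagonal_chord (fun i => PowerSeries.X * PowerSeries.C (x i)) t ht e c _ _
      he' hc' rfl rfl
    have h4 : (∑ j, ∑ i, (if j ≠ i then
        pathSeries x j i * (PowerSeries.X ^ 2 * PowerSeries.C (g j i)) else 0)) * (1 - ∑ k, t k)
        = ∑ i, ∑ j, (if i ≠ j then t i * t j *
          (c - PowerSeries.X * PowerSeries.C (x i) * (e - PowerSeries.X * PowerSeries.C (x i))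
            - PowerSeries.X * PowerSeries.C (x j) * (e - PowerSeries.X * PowerSeries.C (x j))
            + PowerSeries.X * PowerSeries.C (x i) * (PowerSeries.X * PowerSeries.C (x j)))
          else 0) := by
      rw [Finset.sum_mul]
      refine Finset.sum_congr rfl fun j _ => ?_
      rw [Finset.sum_mul]
      refine Finset.sum_congr rfl fun i _ => ?_
      split_ifs with h
      · rw [mul_right_comm, mul_pathSeries_of_ne x t ht hu h]
        congr 1
        simp only [hg]
        rw [sum_two_interior x (Ne.symm h), ← two_mul_finEsymm_two, ← finEsymm_one, hc, he]
        simp only [map_add, map_sub, map_mul]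
        ring
      · simp
    linear_combination esymmSeries x * h4 + esymmSeries x * key

/-! ### Colourings of the cycle-chord graph as path colourings with two further vertices. -/

theorem sum_fin_succ_fun {ι A : Type*} [Fintype ι] [DecidableEq ι] [AddCommMonoid A] {n : ℕ}
    (f : (Fin (n + 1) → ι) → A) :
    ∑ κ, f κ = ∑ κ : Fin n → ι, ∑ i, f (Fin.snoc (α := fun _ => ι) κ i) := by
  rw [← (Fin.snocEquiv fun _ => ι).sum_comp f, Fintype.sum_prod_type, Finset.sum_comm]
  rfl

theorem sum_path_colorings {ι R : Type*} [Fintype ι] [DecidableEq ι] [CommRing R]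
    (x : ι → R) (n : ℕ) (F : ι → ι → R) :
    ∑ κ : Fin (n + 1) → ι, (if ∀ k : Fin n, κ k.castSucc ≠ κ k.succ then
        (∏ v, x (κ v)) * F (κ 0) (κ (Fin.last n)) else 0)
      = ∑ j, ∑ i, pathWeight x n j i * F j i := by
  induction n generalizing F with
  | zero =>
    rw [← (Equiv.funUnique (Fin 1) ι).symm.sum_comp]
    refine Finset.sum_congr rfl fun j _ => ?_
    simp [pathWeight]
  | succ n ih =>
    rw [sum_fin_succ_fun]
    have h : ∀ (κ : Fin (n + 1) → ι), ∑ i,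
        (if ∀ k : Fin (n + 1), (Fin.snoc (α := fun _ => ι) κ i : Fin (n + 2) → ι) k.castSucc
            ≠ (Fin.snoc (α := fun _ => ι) κ i : Fin (n + 2) → ι) k.succ then
          (∏ v, x ((Fin.snoc (α := fun _ => ι) κ i : Fin (n + 2) → ι) v))
            * F ((Fin.snoc (α := fun _ => ι) κ i : Fin (n + 2) → ι) 0)
              ((Fin.snoc (α := fun _ => ι) κ i : Fin (n + 2) → ι) (Fin.last (n + 1))) else 0)
        = if ∀ k : Fin n, κ k.castSucc ≠ κ k.succ then (∏ v, x (κ v)) *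
          (fun j k => ∑ i, if k ≠ i then x i * F j i else 0) (κ 0) (κ (Fin.last n)) else 0 := by
      intro κ
      split_ifs with hκ
      · rw [Finset.mul_sum]
        refine Finset.sum_congr rfl fun i _ => ?_
        have h0 : (Fin.snoc (α := fun _ => ι) κ i : Fin (n + 2) → ι) 0 = κ 0 :=
          Fin.snoc_castSucc (α := fun _ => ι) i κ 0
        simp only [Fin.forall_fin_succ' (n := n), Fin.prod_univ_castSucc (n := n + 1), h0, Fin.succ_castSucc, Fin.snoc_castSucc, Fin.succ_last, Fin.snoc_last, hκ,
          true_and, ne_eq, not_false_eq_true, implies_true]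
        split_ifs
        · simp
        · ring
      · refine Finset.sum_eq_zero fun i _ => if_neg fun h => hκ fun k => ?_
        have := h k.castSucc
        rwa [Fin.succ_castSucc, Fin.snoc_castSucc, Fin.snoc_castSucc] at this
    -- The last vertex is summed out and absorbed into the end weight, which is why the induction
    -- generalizes `F`.
    rw [Finset.sum_congr rfl fun κ _ => h κ,
      ih fun j k => ∑ i, if k ≠ i then x i * F j i else 0]
    refine Finset.sum_congr rfl fun j _ => ?_
    simp only [pathWeight, Finset.mul_sum, Finset.sum_mul]
    rw [Finset.sum_comm]
    refine Finset.sum_congr rfl fun i _ => Finset.sum_congr rfl fun k _ => ?_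
    split_ifs <;> ring

theorem cycleGraph_coloring_iff {ι : Type*} {n : ℕ} (κ : Fin (n + 2) → ι) :
    (∀ u v, (SimpleGraph.cycleGraph (n + 2)).Adj u v → κ u ≠ κ v) ↔
      (∀ k : Fin (n + 1), κ k.castSucc ≠ κ k.succ) ∧ κ (Fin.last (n + 1)) ≠ κ 0 := by
  constructor
  · refine fun h => ⟨fun k => h _ _ ?_, h _ _ ?_⟩
    · rw [SimpleGraph.cycleGraph_adj]
      exact Or.inr (by rw [← Fin.coeSucc_eq_succ]; abel)
    · rw [SimpleGraph.cycleGraph_adj]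
      exact Or.inr (sub_eq_iff_eq_add'.2 (Fin.last_add_one _).symm)
  · rintro ⟨h1, h2⟩
    have key : ∀ u v : Fin (n + 2), v - u = 1 → κ u ≠ κ v := by
      intro u v huv
      obtain rfl : v = u + 1 := by rw [← huv]; abel
      induction u using Fin.lastCases with
      | last => simpa [Fin.last_add_one] using h2
      | cast k => rw [Fin.coeSucc_eq_succ]; exact h1 k
    intro u v huv
    rw [SimpleGraph.cycleGraph_adj] at huv
    rcases huv with h | h
    · exact (key v u h).symm
    · exact key u v h

theorem cycleChordGraph_coloring_iff {ι : Type*} (a : ℕ) (ha : 0 < a) (κ : Fin (a + 3) → ι) :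
    (∀ u v, (cycleChordGraph a 3).Adj u v → κ u ≠ κ v) ↔
      ((∀ k : Fin (a + 2), κ k.castSucc ≠ κ k.succ) ∧ κ (Fin.last (a + 2)) ≠ κ 0) ∧
        κ 0 ≠ κ ⟨a, by omega⟩ := by
  rw [← cycleGraph_coloring_iff (n := a + 1)]
  constructor
  · refine fun h => ⟨fun u v huv => h u v (Or.inl huv), h _ _ (Or.inr ?_)⟩
    rw [SimpleGraph.fromRel_adj]
    -- For `a = 0` the chord would be a loop, which `fromRel` discards.
    refine ⟨fun h => ?_, Or.inl ⟨rfl, rfl⟩⟩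
    have := congrArg Fin.val h
    simp at this
    omega
  · rintro ⟨h1, h2⟩ u v (h | h)
    · exact h1 u v h
    · rw [SimpleGraph.fromRel_adj] at h
      have h0 : ∀ w : Fin (a + 3), w.val = 0 → w = 0 := fun w hw => Fin.ext hw
      have h0' : ∀ w : Fin (a + 3), w.val = a → w = ⟨a, by omega⟩ := fun w hw => Fin.ext hw
      rcases h.2 with ⟨hu, hv⟩ | ⟨hu, hv⟩
      · rw [h0 u hu, h0' v hv]; exact h2
      · rw [h0 v hu, h0' u hv]; exact h2.symm

open Classical in
theorem sum_cycleChordGraph_colorings {ι R : Type*} [Fintype ι] [CommRing R]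
    (x : ι → R) (a : ℕ) (ha : 0 < a) :
    ∑ κ : Fin (a + 3) → ι, (if ∀ u v, (cycleChordGraph a 3).Adj u v → κ u ≠ κ v then
        ∏ v, x (κ v) else 0)
      = chordRec (finEsymm x) (chordNum (finEsymm x)) (a + 3) := by
  rw [← sum_pathWeight_eq_chordRec]
  have hF : ∀ j i, (if j ≠ i then pathWeight x a j i *
        ∑ k, ∑ l, (if k ≠ i ∧ l ≠ j ∧ k ≠ l then x k * x l else 0) else 0)
      = pathWeight x a j i * (fun j i => if j ≠ i then
        ∑ k, ∑ l, (if k ≠ i ∧ l ≠ j ∧ k ≠ l then x k * x l else 0) else 0) j i := by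
    intro j i
    split_ifs <;> simp_all
  simp only [hF]
  rw [← sum_path_colorings, sum_fin_succ_fun, sum_fin_succ_fun]
  refine Finset.sum_congr rfl fun κ _ => ?_
  have h : ∀ k l, (∀ u v, (cycleChordGraph a 3).Adj u v →
      (Fin.snoc (α := fun _ => ι) (Fin.snoc (α := fun _ => ι) κ k : Fin (a + 2) → ι) l :
        Fin (a + 3) → ι) u ≠
      (Fin.snoc (α := fun _ => ι) (Fin.snoc (α := fun _ => ι) κ k : Fin (a + 2) → ι) l :
        Fin (a + 3) → ι) v) ↔ (∀ r : Fin a, κ r.castSucc ≠ κ r.succ) ∧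
          κ 0 ≠ κ (Fin.last a) ∧ (k ≠ κ (Fin.last a) ∧ l ≠ κ 0 ∧ k ≠ l) := by
    intro k l
    have h0 : (Fin.snoc (α := fun _ => ι) (Fin.snoc (α := fun _ => ι) κ k : Fin (a + 2) → ι) l :
        Fin (a + 3) → ι) 0 = κ 0 :=
      (Fin.snoc_castSucc (α := fun _ => ι) l _ 0).trans (Fin.snoc_castSucc (α := fun _ => ι) k κ 0)
    have h1 : (Fin.snoc (α := fun _ => ι) (Fin.snoc (α := fun _ => ι) κ k : Fin (a + 2) → ι) l :
        Fin (a + 3) → ι) ⟨a, by omega⟩ = κ (Fin.last a) :=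
      (Fin.snoc_castSucc (α := fun _ => ι) l _ (Fin.last a).castSucc).trans
        (Fin.snoc_castSucc (α := fun _ => ι) k κ (Fin.last a))
    rw [cycleChordGraph_coloring_iff a ha, h0, h1, Fin.forall_fin_succ', Fin.forall_fin_succ']
    simp only [Fin.succ_castSucc, Fin.snoc_castSucc, Fin.succ_last, Fin.snoc_last]
    constructor
    · rintro ⟨⟨⟨⟨h1, h2⟩, h3⟩, h4⟩, h5⟩
      exact ⟨h1, h5, h2.symm, h4, h3⟩
    · rintro ⟨h1, h5, h2, h4, h3⟩
      exact ⟨⟨⟨⟨h1, h2.symm⟩, h3⟩, h4⟩, h5⟩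
  simp only [h, Fin.prod_univ_castSucc (n := a + 2), Fin.prod_univ_castSucc (n := a + 1),
    Fin.snoc_castSucc, Fin.snoc_last]
  by_cases hc : ∀ r : Fin a, κ r.castSucc ≠ κ r.succ
  · by_cases h5 : κ 0 ≠ κ (Fin.last a)
    · simp only [hc, h5, if_true, true_and, Finset.mul_sum, ne_eq, not_false_eq_true,
        implies_true]
      refine Finset.sum_congr rfl fun k _ => Finset.sum_congr rfl fun l _ => ?_
      split_ifs <;> ring
    · simp [h5]
  · simp only [hc, false_and, if_false, Finset.sum_const_zero]

/-! ### From finitely many variables to all. -/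

/-- Two power series agree on the monomials in the variables indexed by `s`. -/
def AgreeOn (s : Finset ℕ) (f g : MvPowerSeries ℕ ℚ) : Prop :=
  ∀ m : ℕ →₀ ℕ, m.support ⊆ s → MvPowerSeries.coeff m f = MvPowerSeries.coeff m g

theorem AgreeOn.refl (s : Finset ℕ) (f : MvPowerSeries ℕ ℚ) : AgreeOn s f f := fun _ _ => rfl

theorem AgreeOn.add {s : Finset ℕ} {f g f' g' : MvPowerSeries ℕ ℚ} (h : AgreeOn s f g)
    (h' : AgreeOn s f' g') : AgreeOn s (f + f') (g + g') := fun m hm => by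
  rw [map_add, map_add, h m hm, h' m hm]

theorem AgreeOn.mul {s : Finset ℕ} {f g f' g' : MvPowerSeries ℕ ℚ} (h : AgreeOn s f g)
    (h' : AgreeOn s f' g') : AgreeOn s (f * f') (g * g') := fun m hm => by
  classical
  rw [MvPowerSeries.coeff_mul, MvPowerSeries.coeff_mul]
  refine Finset.sum_congr rfl fun p hp => ?_
  have hp : p.1 + p.2 = m := Finset.HasAntidiagonal.mem_antidiagonal.1 hp
  rw [h p.1 ((Finsupp.support_mono (hp ▸ le_self_add)).trans hm),
    h' p.2 ((Finsupp.support_mono (hp ▸ le_add_self)).trans hm)]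

theorem AgreeOn.sum {α : Type*} {s : Finset ℕ} (t : Finset α) {f g : α → MvPowerSeries ℕ ℚ}
    (h : ∀ a ∈ t, AgreeOn s (f a) (g a)) : AgreeOn s (∑ a ∈ t, f a) (∑ a ∈ t, g a) :=
  fun m hm => by
    rw [map_sum, map_sum]
    exact Finset.sum_congr rfl fun a ha => h a ha m hm

theorem AgreeOn.chordNum {s : Finset ℕ} {e e' : ℕ → MvPowerSeries ℕ ℚ}
    (h : ∀ k, AgreeOn s (e k) (e' k)) (n : ℕ) :
    AgreeOn s (chordNum e n) (chordNum e' n) := by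
  unfold ChromaticSymm.chordNum
  split_ifs
  · exact .refl _ _
  · exact (((AgreeOn.refl _ _).mul (h _)).add ((AgreeOn.refl _ _).mul ((h _).mul (h _)))).add
      ((AgreeOn.refl _ _).mul ((h _).mul (h _)))

theorem AgreeOn.chordRec {s : Finset ℕ} {e e' num num' : ℕ → MvPowerSeries ℕ ℚ}
    (h : ∀ k, AgreeOn s (e k) (e' k)) (h' : ∀ k, AgreeOn s (num k) (num' k)) (n : ℕ) :
    AgreeOn s (chordRec e num n) (chordRec e' num' n) := by
  induction n using Nat.strong_induction_on with
  | _ n ih =>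
    rw [ChromaticSymm.chordRec, ChromaticSymm.chordRec]
    exact (h' n).add (AgreeOn.sum _ fun j _ =>
      (AgreeOn.refl _ _).mul ((h _).mul (ih j j.isLt)))

theorem prod_X_eq_monomial {α : Type*} (t : Finset α) (f : α → ℕ) :
    ∏ a ∈ t, (MvPowerSeries.X (f a) : MvPowerSeries ℕ ℚ)
      = MvPowerSeries.monomial (∑ a ∈ t, Finsupp.single (f a) 1) 1 := by
  classical
  induction t using Finset.induction_on with
  | empty => simp
  | insert a t ha ih =>
    rw [prod_insert ha, sum_insert ha, ih, MvPowerSeries.X_def,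
      MvPowerSeries.monomial_mul_monomial, one_mul]

theorem sum_single_subtype_apply {s : Finset ℕ} (t : Finset s) (i : s) :
    (∑ j ∈ t, Finsupp.single (j : ℕ) 1 : ℕ →₀ ℕ) i = if i ∈ t then 1 else 0 := by
  classical
  rw [Finsupp.finsetSum_apply]
  simp only [Finsupp.single_apply, ← Subtype.ext_iff]
  rw [Finset.sum_ite_eq']

theorem agreeOn_elemSymm (s : Finset ℕ) (k : ℕ) :
    AgreeOn s (elemSymm k) (finEsymm (fun i : s => MvPowerSeries.X (i : ℕ)) k) := by
  classical
  intro m hm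
  have hm0 : ∀ j, j ∉ s → m j = 0 := fun j hj => by
    by_contra h
    exact hj (hm (Finsupp.mem_support_iff.2 h))
  rw [finEsymm, map_sum]
  simp only [prod_X_eq_monomial, MvPowerSeries.coeff_monomial]
  change (if (∀ i, m i ≤ 1) ∧ m.support.card = k then (1 : ℚ) else 0) = _
  by_cases h1 : ∀ i, m i ≤ 1
  · set t₀ : Finset s := univ.filter fun i : s => m i ≠ 0 with ht₀
    have hcard : #t₀ = #m.support := by
      rw [← Finset.card_map (Function.Embedding.subtype (· ∈ s))]
      congr 1
      ext j
      simp only [ht₀, Finset.mem_map, mem_filter, mem_univ, true_and,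
        Function.Embedding.subtype_apply, Finsupp.mem_support_iff]
      constructor
      · rintro ⟨i, hi, rfl⟩
        exact hi
      · exact fun hj => ⟨⟨j, hm (Finsupp.mem_support_iff.2 hj)⟩, hj, rfl⟩
    have ht : ∀ t : Finset s, m = ∑ i ∈ t, Finsupp.single (i : ℕ) 1 ↔ t₀ = t := by
      intro t
      constructor
      · intro h
        ext i
        rw [ht₀, mem_filter, h, sum_single_subtype_apply]
        simp
      · rintro rfl
        ext j
        by_cases hj : j ∈ s
        · rw [sum_single_subtype_apply t₀ ⟨j, hj⟩, ht₀]
          simp only [mem_filter, mem_univ, true_and]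
          have := h1 j
          split_ifs with h <;> omega
        · rw [hm0 j hj, Finsupp.finsetSum_apply]
          refine (Finset.sum_eq_zero fun i _ => ?_).symm
          rw [Finsupp.single_apply, if_neg fun (h : (i : ℕ) = j) => hj (h ▸ i.2)]
    simp only [ht, Finset.sum_ite_eq, mem_powersetCard_univ, hcard, h1, implies_true, true_and]
  · rw [if_neg fun h => h1 h.1]
    refine (Finset.sum_eq_zero fun t _ => if_neg fun h => h1 fun j => ?_).symm
    by_cases hj : j ∈ s
    · rw [h, sum_single_subtype_apply t ⟨j, hj⟩]
      split_ifs <;> simp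
    · simp [hm0 j hj]

open Classical in
theorem agreeOn_chromaticSymm {V : Type*} [Fintype V] [DecidableEq V] (G : SimpleGraph V) (s : Finset ℕ) :
    AgreeOn s (chromaticSymm G) (∑ κ : V → s, (if ∀ u v, G.Adj u v → κ u ≠ κ v then
      ∏ v, MvPowerSeries.X (κ v : ℕ) else 0)) := by
  intro m hm
  have hmem : ∀ κ : V → ℕ, content κ = m → ∀ v, κ v ∈ s := by
    rintro κ rfl v
    refine hm (Finsupp.mem_support_iff.2 fun h => ?_)
    rw [content, Finsupp.finsetSum_apply, Finset.sum_eq_zero_iff] at h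
    simpa using h v (mem_univ v)
  have h : ∀ κ : V → s, MvPowerSeries.coeff m (if ∀ u v, G.Adj u v → κ u ≠ κ v then
      ∏ v, (MvPowerSeries.X (κ v : ℕ) : MvPowerSeries ℕ ℚ) else 0)
      = if (∀ u v, G.Adj u v → κ u ≠ κ v) ∧ content (fun v => (κ v : ℕ)) = m then 1 else 0 := by
    intro κ
    rw [prod_X_eq_monomial, ← content]
    split_ifs with h1 h2 h2
    · rw [MvPowerSeries.coeff_monomial, if_pos h2.2.symm]
    · rw [MvPowerSeries.coeff_monomial, if_neg fun h => h2 ⟨h1, h.symm⟩]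
    · exact absurd h2.1 h1
    · simp
  rw [map_sum]
  simp only [h]
  rw [Finset.sum_boole, ← Fintype.card_subtype, ← Nat.card_eq_fintype_card]
  change ((Nat.card {κ : G.Coloring ℕ // content (fun v => κ v) = m} : ℕ) : ℚ) = _
  congr 1
  exact Nat.card_congr
    { toFun := fun κ => ⟨fun v => ⟨κ.1 v, hmem _ κ.2 v⟩,
        fun u v huv h => κ.1.valid huv (congrArg Subtype.val h), κ.2⟩
      invFun := fun κ => ⟨SimpleGraph.Coloring.mk (fun v => (κ.1 v : ℕ))
        fun {u v} huv h => κ.2.1 u v huv (Subtype.ext h), κ.2.2⟩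
      left_inv := fun κ => rfl
      right_inv := fun κ => rfl }

theorem chromaticSymm_cycleChordGraph (a : ℕ) (ha : 0 < a) :
    chromaticSymm (cycleChordGraph a 3) = chordRec elemSymm (chordNum elemSymm) (a + 3) := by
  ext m
  have h := sum_cycleChordGraph_colorings
    (fun i : m.support => (MvPowerSeries.X (i : ℕ) : MvPowerSeries ℕ ℚ)) a ha
  -- The coefficient at `m` only sees the variables in its own support, a finite set of colours.
  rw [agreeOn_chromaticSymm _ m.support m subset_rfl]
  refine Eq.trans (congrArg _ (Eq.trans ?_ h)) ?_
  · refine Finset.sum_congr rfl fun κ _ => ?_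
    congr
  · exact (AgreeOn.chordRec (agreeOn_elemSymm _) (AgreeOn.chordNum (agreeOn_elemSymm _)) _ m
      subset_rfl).symm

/-! ### Closure properties of `e`-positivity. -/

theorem EPositive.zero : EPositive 0 := ⟨0, fun _ => le_rfl, by simp⟩

theorem EPositive.add {f g : MvPowerSeries ℕ ℚ} (hf : EPositive f) (hg : EPositive g) :
    EPositive (f + g) := by
  obtain ⟨c, hc, rfl⟩ := hf
  obtain ⟨d, hd, rfl⟩ := hg
  refine ⟨c + d, fun p => add_nonneg (hc p) (hd p), ?_⟩
  exact (Finsupp.sum_add_index'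
    (h := fun (p : Σ n : ℕ, n.Partition) (a : ℚ) => a • elemSymmPart p.2) (fun _ => zero_smul _ _)
    fun _ _ _ => add_smul _ _ _).symm

theorem EPositive.sum {α : Type*} (t : Finset α) {f : α → MvPowerSeries ℕ ℚ}
    (h : ∀ a ∈ t, EPositive (f a)) : EPositive (∑ a ∈ t, f a) :=
  Finset.sum_induction f EPositive (fun _ _ => EPositive.add) .zero h

theorem EPositive.smul_elemSymmPart {n : ℕ} (p : n.Partition) {a : ℚ} (ha : 0 ≤ a) :
    EPositive (a • elemSymmPart p) := by
  classical
  refine ⟨Finsupp.single ⟨n, p⟩ a, fun q => ?_, ?_⟩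
  · rw [Finsupp.single_apply]
    split_ifs <;> simp [ha]
  · exact (Finsupp.sum_single_index (a := (⟨n, p⟩ : Σ n : ℕ, n.Partition)) (b := a)
      (h := fun (p : Σ n : ℕ, n.Partition) (a : ℚ) => a • elemSymmPart p.2) (zero_smul _ _)).symm

theorem elemSymmPart_mul {n k : ℕ} (p : n.Partition) (q : k.Partition) :
    ∃ r : (n + k).Partition, elemSymmPart p * elemSymmPart q = elemSymmPart r := by
  refine ⟨⟨p.parts + q.parts, fun {i} hi => ?_, ?_⟩, ?_⟩
  · rcases Multiset.mem_add.1 hi with h | h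
    exacts [p.parts_pos h, q.parts_pos h]
  · rw [Multiset.sum_add, p.parts_sum, q.parts_sum]
  · simp [elemSymmPart]

theorem EPositive.mul {f g : MvPowerSeries ℕ ℚ} (hf : EPositive f) (hg : EPositive g) :
    EPositive (f * g) := by
  obtain ⟨c, hc, rfl⟩ := hf
  obtain ⟨d, hd, rfl⟩ := hg
  rw [Finsupp.sum, Finsupp.sum, Finset.sum_mul_sum]
  refine EPositive.sum _ fun p _ => EPositive.sum _ fun q _ => ?_
  obtain ⟨r, hr⟩ := elemSymmPart_mul p.2 q.2
  rw [smul_mul_smul_comm, hr]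
  exact .smul_elemSymmPart r (mul_nonneg (hc p) (hd q))

theorem EPositive.natCast (n : ℕ) : EPositive n := by
  have h := EPositive.smul_elemSymmPart (Nat.Partition.indiscrete 0) (Nat.cast_nonneg (α := ℚ) n)
  convert h using 1
  simp [elemSymmPart, Nat.Partition.indiscrete, Nat.cast_smul_eq_nsmul]

theorem elemSymm_zero : elemSymm 0 = 1 := by
  classical
  ext m
  rw [MvPowerSeries.coeff_one]
  change (if (∀ i, m i ≤ 1) ∧ m.support.card = 0 then (1 : ℚ) else 0) = _
  refine if_congr ?_ rfl rfl
  rw [Finset.card_eq_zero, Finsupp.support_eq_empty]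
  exact ⟨fun h => h.2, by rintro rfl; simp⟩

theorem EPositive.elemSymm (k : ℕ) : EPositive (elemSymm k) := by
  -- The one-part partition needs `k > 0`; `e_0` is instead the empty product.
  rcases Nat.eq_zero_or_pos k with rfl | hk
  · rw [elemSymm_zero, ← Nat.cast_one]
    exact .natCast 1
  · have h := EPositive.smul_elemSymmPart (Nat.Partition.indiscrete k) zero_le_one
    convert h using 1
    simp [elemSymmPart, Nat.Partition.indiscrete_parts hk.ne']

theorem EPositive.chordNum (n : ℕ) : EPositive (chordNum ChromaticSymm.elemSymm n) := by
  unfold ChromaticSymm.chordNum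
  split_ifs
  · exact .zero
  · exact (((EPositive.natCast _).mul (.elemSymm _)).add
      ((EPositive.natCast _).mul ((EPositive.elemSymm _).mul (.elemSymm _)))).add
      ((EPositive.natCast _).mul ((EPositive.elemSymm _).mul (.elemSymm _)))

theorem EPositive.chordRec {num : ℕ → MvPowerSeries ℕ ℚ} (hnum : ∀ n, EPositive (num n)) (n : ℕ) :
    EPositive (chordRec ChromaticSymm.elemSymm num n) := by
  induction n using Nat.strong_induction_on with
  | _ n ih =>
    rw [ChromaticSymm.chordRec]
    exact (hnum n).add (EPositive.sum _ fun j _ =>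
      (EPositive.natCast _).mul ((EPositive.elemSymm _).mul (ih j j.isLt)))

theorem graphEPositive_cycleChordGraph_three (a : ℕ) (ha : 0 < a) :
    GraphEPositive (cycleChordGraph a 3) := by
  rw [GraphEPositive, chromaticSymm_cycleChordGraph a ha]
  exact .chordRec .chordNum _

/-! ### Isomorphism invariance and rotation of the cycle. -/

theorem chromaticSymm_congr {V W : Type*} [Fintype V] [Fintype W] {G : SimpleGraph V}
    {H : SimpleGraph W} (φ : G ≃g H) : chromaticSymm G = chromaticSymm H := by
  have hcontent : ∀ κ : W → ℕ, content (fun v => κ (φ v)) = content κ := fun κ =>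
    φ.toEquiv.sum_comp fun w => Finsupp.single (κ w) 1
  ext m
  change ((Nat.card {κ : G.Coloring ℕ // content (fun v => κ v) = m} : ℕ) : ℚ)
    = ((Nat.card {κ : H.Coloring ℕ // content (fun v => κ v) = m} : ℕ) : ℚ)
  congr 1
  refine Nat.card_congr (Equiv.subtypeEquiv
    { toFun := fun κ => κ.comp φ.symm.toHom
      invFun := fun κ => κ.comp φ.toHom
      left_inv := fun κ => by ext v; simp
      right_inv := fun κ => by ext v; simp } fun κ => ?_)
  rw [← hcontent]
  simp

/-- Rotating the cycle by one step moves the chord. -/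
def cycleWithChordRotate (n i j : ℕ) (hi : i + 1 < n + 2) (hj : j + 1 < n + 2) :
    cycleWithChord (n + 2) i j ≃g cycleWithChord (n + 2) (i + 1) (j + 1) where
  toEquiv := Equiv.addRight 1
  map_rel_iff' := by
    have h : ∀ (w : Fin (n + 2)) (k : ℕ), k + 1 < n + 2 → ((w + 1).val = k + 1 ↔ w.val = k) := by
      intro w k hk
      rw [Fin.val_add_one]
      split_ifs with h
      · subst h
        simp
        omega
      · omega
    intro u v
    simp only [cycleWithChord, SimpleGraph.sup_adj, SimpleGraph.cycleGraph_adj,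
      SimpleGraph.fromRel_adj, Equiv.coe_addRight, add_sub_add_right_eq_sub, h _ i hi, h _ j hj,
      ne_eq, add_left_inj]

end ChromaticSymm

theorem mainTheorem4 (m : ℕ) (hm : 3 ≤ m) :
    ChromaticSymm.GraphEPositive (ChromaticSymm.cycleChordGraph m 3) ∧
      ChromaticSymm.GraphEPositive (ChromaticSymm.cycleWithChord (m + 2) 1 m) := by
  refine ⟨ChromaticSymm.graphEPositive_cycleChordGraph_three m (by omega), ?_⟩
  -- Rotating back by one step turns the chord `1, a + 1` into `0, a` on `a + 3` vertices.
  obtain ⟨a, rfl⟩ : ∃ a, m = a + 1 := ⟨m - 1, by omega⟩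
  rw [ChromaticSymm.GraphEPositive, ← ChromaticSymm.chromaticSymm_congr
    (ChromaticSymm.cycleWithChordRotate (a + 1) 0 a (by omega) (by omega))]
  exact ChromaticSymm.graphEPositive_cycleChordGraph_three a (by omega)
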